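/- Let $\mathbb F$ be a division ring, $\sigma:\mathbb F\to\mathbb F$ a (unital) ring endomorphism and $\delta:\mathbb F\to\mathbb F$ a $\sigma$-derivation, i.e. an additive map with $\delta(ab)=\sigma(a)\delta(b)+\delta(a)b$ for all $a,b$. Let $\mathcal R=\mathbb F[x;\sigma,\delta]$ be the skew polynomial ring, whose elements are written $\sum_i a_ix^i$ with $a_i\in\mathbb F$ and whose product is determined by $xa=\sigma(a)x+\delta(a)$ for $a\in\mathbb F$. For $f\in\mathcal R$ and $a\in\mathbb F$, the right evaluation $f(a)\in\mathbb F$ is the unique remainder of the right division of $f$ by $x-a$, i.e. $f=q\,(x-a)+f(a)$ for some $q\in\mathcal R$. For $d,s\ge 0$ let $\mathcal C_{d,s}(a)$ be the sum of all compositions of $d$ copies of $\delta$ and $s$ copies of $\sigma$, evaluated at $a$ (with $\mathcal C_{0,0}(a)=a$). Let $N_0^{\sigma,\delta}(a)=1$ and $N_{i+1}^{\sigma,\delta}(a)=\sigma(N_i^{\sigma,\delta}(a))\,a+\delta(N_i^{\sigma,\delta}(a))$. For nonzero $f=\sum_{j=0}^m a_jx^j$ and $g=\sum_{j=0}^n b_jx^j$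 in $\mathcal R$ of degrees $m,n\ge 0$, the right $(\sigma,\delta)$-Sylvester matrix of $f$ and $g$ is the $(m+n)\times(m+n)$ matrix over $\mathbb F$, with columns indexed by $q=0,\dots,m+n-1$, whose first $n$ rows ($p=0,\dots,n-1$) have entries $\sum_{l}\mathcal C_{p-l,l}(a_{q-l})$ and whose last $m$ rows ($p=0,\dots,m-1$) have entries $\sum_{l}\mathcal C_{p-l,l}(b_{q-l})$, the sums being over $0\le l\le\min(p,q)$, with $a_j=0$ for $j>m$ and $b_j=0$ for $j>n$. The right $(\sigma,\delta)$-resultant $R^{\sigma,\delta}_{\mathbb F}(f,g)\in\{0\}\cup\mathbb F^*/[\mathbb F^*,\mathbb F^*]$ is the Dieudonné determinant of this matrix. Elements of $\mathbb F$ are read in $\{0\}\cup\mathbb F^*/[\mathbb F^*,\mathbb F^*]$ through their classes $\overline{a}$ (with $\overline 0=0$). Let $f,g\in\mathcal R$ be nonzero skew polynomials of degrees $m,n\geq 0$, respectively. Then: 1. $R^{\sigma,\delta}_{\mathbb F}(g,f)=\overline{(-1)^{mn}}\,R^{\sigma,\delta}_{\mathbb F}(f,g)$. 2. $R^{\sigma,\delta}_{\mathbb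 F}(-f,g)=\overline{(-1)^{n}}\,R^{\sigma,\delta}_{\mathbb F}(f,g)$ and $R^{\sigma,\delta}_{\mathbb F}(f,-g)=\overline{(-1)^{m}}\,R^{\sigma,\delta}_{\mathbb F}(f,g)$. 3. If $g=x-a$ with $a\in\mathbb F$, then $R^{\sigma,\delta}_{\mathbb F}(f,g)=0$ if and only if $f(a)=0$. If moreover $a=0$, then $R^{\sigma,\delta}_{\mathbb F}(f,g)=\overline{f(0)}$. 4. If $g=b_0\in\mathbb F$, then $R^{\sigma,\delta}_{\mathbb F}(f,g)=\overline{b_0\sigma(b_0)\sigma^2(b_0)\cdots\sigma^{m-1}(b_0)}$ (the empty product being $1$). 5. If $\delta=0$ and $c\in\mathbb F^*$, then $R^{\sigma,0}_{\mathbb F}(cf,g)=\overline{N_n^{\sigma,0}(c)}\,R^{\sigma,0}_{\mathbb F}(f,g)$. -/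

import Mathlib

/-- A `σ`-derivation of a division ring `F`: an additive map `δ : F → F` with
`δ (a b) = σ a · δ b + δ a · b`. -/
structure SkewDerivation {F : Type*} [DivisionRing F] (σ : F →+* F) extends F →+ F where
  leibniz' : ∀ a b : F, toFun (a * b) = σ a * toFun b + toFun a * b

namespace SkewDerivation

variable {F : Type*} [DivisionRing F] {σ : F →+* F}

instance : FunLike (SkewDerivation σ) F F where
  coe δ := δ.toFun
  coe_injective := by
    rintro ⟨⟨⟨f, h₁⟩, h₂⟩, h₃⟩ ⟨⟨⟨g, k₁⟩, k₂⟩, k₃⟩ h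
    obtain rfl : f = g := h
    rfl

instance : AddMonoidHomClass (SkewDerivation σ) F F where
  map_add δ := δ.map_add'
  map_zero δ := δ.map_zero'

/-- The zero `σ`-derivation. -/
instance : Zero (SkewDerivation σ) := ⟨{ (0 : F →+ F) with leibniz' := by simp }⟩

theorem leibniz (δ : SkewDerivation σ) (a b : F) : δ (a * b) = σ a * δ b + δ a * b :=
  δ.leibniz' a b

theorem map_one (δ : SkewDerivation σ) : δ 1 = 0 := by
  have h := δ.leibniz 1 1
  simpa using h

end SkewDerivation

/-- The underlying set of the skew polynomial ring `F[x; σ, δ]`: finitely supported families of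
coefficients `(a_i)`, standing for `∑ i, a_i x ^ i` (coefficients on the left). The sum is the
usual one and the left `F`-module structure is coefficientwise. -/
def SkewPoly {F : Type*} [DivisionRing F] {σ : F →+* F} (_δ : SkewDerivation σ) : Type _ :=
  ℕ →₀ F

namespace SkewPoly

variable {F : Type*} [DivisionRing F] {σ : F →+* F} {δ : SkewDerivation σ}

noncomputable instance : AddCommGroup (SkewPoly δ) := inferInstanceAs (AddCommGroup (ℕ →₀ F))

noncomputable instance : Module F (SkewPoly δ) := inferInstanceAs (Module F (ℕ →₀ F))

/-- The coefficient of `x ^ i` (on the left of `x ^ i`). -/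
def coeff (f : SkewPoly δ) (i : ℕ) : F := (show ℕ →₀ F from f) i

/-- The degree of a skew polynomial (`0` for the zero polynomial). -/
def natDegree (f : SkewPoly δ) : ℕ := (show ℕ →₀ F from f).support.sup id

/-- The monomial `a x ^ i`, additively in `a`. -/
noncomputable def monomial (i : ℕ) : F →+ SkewPoly δ :=
  (Finsupp.singleAddHom i : F →+ (ℕ →₀ F))

/-- Constant skew polynomials. -/
noncomputable def C (a : F) : SkewPoly δ := monomial 0 a

/-- The variable `x`. -/
noncomputable def X : SkewPoly δ := monomial 1 1

theorem end_add_apply {M : Type*} [AddCommGroup M] (φ ψ : AddMonoid.End M) (m : M) :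
    (φ + ψ) m = φ m + ψ m := rfl

/-- For a left `F`-vector space `M` and an additive map `T : M → M`, the additive map
`∑ i, a_i x ^ i ↦ (m ↦ ∑ i, a_i • T^i m)`. -/
noncomputable def act {M : Type*} [AddCommGroup M] [Module F M] (T : AddMonoid.End M) :
    SkewPoly δ →+ AddMonoid.End M :=
  (Finsupp.liftAddHom (fun i : ℕ =>
    (AddMonoidHom.mulRight (T ^ i)).comp (Module.toAddMonoidEnd F M).toAddMonoidHom) :
    (ℕ →₀ F) →+ AddMonoid.End M)

/-- Left multiplication by `x`, as dictated by the rule `x a = σ(a) x + δ(a)`: it sends the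
monomial `b x ^ j` to `σ(b) x ^ (j + 1) + δ(b) x ^ j`. -/
noncomputable def xMul (δ : SkewDerivation σ) : AddMonoid.End (SkewPoly δ) :=
  (Finsupp.liftAddHom (fun j : ℕ =>
    ((monomial (j + 1)).comp σ.toAddMonoidHom + (monomial j).comp δ.toAddMonoidHom :
      F →+ SkewPoly δ)) : (ℕ →₀ F) →+ SkewPoly δ)

/-- The product `(∑ i, a_i x ^ i) * g = ∑ i, a_i • (x * (x * ⋯ (x * g)))`. -/
noncomputable instance : Mul (SkewPoly δ) := ⟨fun f g => act (xMul δ) f g⟩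

noncomputable instance : One (SkewPoly δ) := ⟨C 1⟩

theorem mul_def (f g : SkewPoly δ) : f * g = act (xMul δ) f g := rfl

theorem one_def : (1 : SkewPoly δ) = C 1 := rfl

@[elab_as_elim]
theorem induction_on {P : SkewPoly δ → Prop} (f : SkewPoly δ) (h0 : P 0)
    (hadd : ∀ f g, P f → P g → P (f + g)) (hmon : ∀ i a, P (monomial i a)) : P f :=
  Finsupp.induction_linear (motive := P) f h0 hadd hmon

theorem smul_monomial (a b : F) (i : ℕ) :
    a • (monomial i b : SkewPoly δ) = monomial i (a * b) :=
  Finsupp.smul_single' a i b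

theorem xMul_monomial (j : ℕ) (b : F) :
    xMul δ (monomial j b) = monomial (j + 1) (σ b) + monomial j (δ b) :=
  Finsupp.liftAddHom_apply_single (M := F) (N := SkewPoly δ) _ j b

theorem xMul_smul (a : F) (p : SkewPoly δ) :
    xMul δ (a • p) = σ a • xMul δ p + δ a • p := by
  induction p using induction_on with
  | h0 => simp
  | hadd f g hf hg => simp only [smul_add, map_add, hf, hg]; abel
  | hmon i b =>
    rw [smul_monomial, xMul_monomial, xMul_monomial, smul_add, smul_monomial, smul_monomial,
      smul_monomial, map_mul, δ.leibniz, map_add]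
    abel

section act

variable {M : Type*} [AddCommGroup M] [Module F M]

theorem act_monomial (T : AddMonoid.End M) (i : ℕ) (a : F) (m : M) :
    act (δ := δ) T (monomial i a) m = a • (T ^ i) m :=
  congrArg (fun φ : AddMonoid.End M => φ m)
    (Finsupp.liftAddHom_apply_single (M := F) (N := AddMonoid.End M) _ i a)

theorem act_smul (T : AddMonoid.End M) (a : F) (p : SkewPoly δ) (m : M) :
    act T (a • p) m = a • act T p m := by
  induction p using induction_on with
  | h0 => simp
  | hadd f g hf hg =>
    simp only [smul_add, map_add, end_add_apply, hf, hg]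
  | hmon i b => rw [smul_monomial, act_monomial, act_monomial, mul_smul]

theorem act_xMul (T : AddMonoid.End M)
    (hT : ∀ (c : F) (m : M), T (c • m) = σ c • T m + δ c • m) (p : SkewPoly δ) (m : M) :
    act T (xMul δ p) m = T (act T p m) := by
  induction p using induction_on with
  | h0 => simp
  | hadd f g hf hg => simp only [map_add, end_add_apply, hf, hg]
  | hmon i b =>
    rw [xMul_monomial, map_add, end_add_apply, act_monomial, act_monomial, act_monomial,
      hT, pow_succ']
    rfl

theorem act_mul (T : AddMonoid.End M)
    (hT : ∀ (c : F) (m : M), T (c • m) = σ c • T m + δ c • m) (f g : SkewPoly δ) (m : M) :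
    act T (f * g) m = act T f (act T g m) := by
  rw [mul_def]
  induction f using induction_on with
  | h0 => simp
  | hadd f f' hf hf' => simp only [map_add, end_add_apply, hf, hf']
  | hmon i a =>
    rw [act_monomial, act_monomial, act_smul]
    congr 1
    induction i with
    | zero => rfl
    | succ i ih =>
      rw [pow_succ', pow_succ']
      change act T (xMul δ ((xMul δ ^ i) g)) m = T ((T ^ i) (act T g m))
      rw [act_xMul T hT, ih]

end act

theorem xMul_pow_one (i : ℕ) : (xMul δ ^ i) (C 1 : SkewPoly δ) = monomial i 1 := by
  induction i with
  | zero => rfl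
  | succ i ih =>
    rw [pow_succ']
    change xMul δ ((xMul δ ^ i) (C 1)) = _
    rw [ih, xMul_monomial, δ.map_one, map_one, map_zero, add_zero]

/-- `F[x; σ, δ]` is a ring. -/
noncomputable instance : Ring (SkewPoly δ) :=
  { (inferInstance : AddCommGroup (SkewPoly δ)), (inferInstance : Mul (SkewPoly δ)),
    (inferInstance : One (SkewPoly δ)) with
    left_distrib := fun f g h => by simp only [mul_def, map_add]
    right_distrib := fun f g h => by simp only [mul_def, map_add, end_add_apply]
    zero_mul := fun f => by simp [mul_def]
    mul_zero := fun f => by simp [mul_def]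
    mul_assoc := fun f g h => act_mul (xMul δ) xMul_smul f g h
    one_mul := fun f => by
      rw [one_def, mul_def, C, act_monomial, one_smul]; rfl
    mul_one := fun f => by
      rw [one_def, mul_def]
      induction f using induction_on with
      | h0 => simp
      | hadd f g hf hg => rw [map_add, end_add_apply, hf, hg]
      | hmon i a => rw [act_monomial, xMul_pow_one, smul_monomial, mul_one]
    zsmul := (inferInstance : AddCommGroup (SkewPoly δ)).zsmul
    zsmul_zero' := (inferInstance : AddCommGroup (SkewPoly δ)).zsmul_zero'
    zsmul_succ' := (inferInstance : AddCommGroup (SkewPoly δ)).zsmul_succ'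
    zsmul_neg' := (inferInstance : AddCommGroup (SkewPoly δ)).zsmul_neg' }

theorem X_mul (p : SkewPoly δ) : X * p = xMul δ p := by
  rw [mul_def, X, act_monomial, one_smul, pow_one]

theorem C_mul (a : F) (p : SkewPoly δ) : C a * p = a • p := by
  rw [mul_def, C, act_monomial, pow_zero]; rfl

/-- The defining rule `x a = σ(a) x + δ(a)`. -/
theorem X_mul_C (a : F) : (X * C a : SkewPoly δ) = C (σ a) * X + C (δ a) := by
  rw [X_mul, C_mul, C, xMul_monomial, X, smul_monomial, mul_one]; rfl

theorem monomial_eq (i : ℕ) (a : F) : (monomial i a : SkewPoly δ) = C a * X ^ i := by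
  have h : (X ^ i : SkewPoly δ) = monomial i 1 := by
    induction i with
    | zero => rfl
    | succ i ih =>
      rw [pow_succ', ih, X_mul, xMul_monomial, δ.map_one, map_one, map_zero, add_zero]
  rw [h, C_mul, smul_monomial, mul_one]

theorem C_add (a b : F) : (C (a + b) : SkewPoly δ) = C a + C b := map_add _ a b

theorem C_sub (a b : F) : (C (a - b) : SkewPoly δ) = C a - C b := map_sub _ a b

theorem C_mul_C (a b : F) : (C a * C b : SkewPoly δ) = C (a * b) := by
  rw [C_mul]; exact smul_monomial a b 0

/-- Right division of `f` by `x - a` has a unique remainder. -/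
theorem existsUnique_remainder (f : SkewPoly δ) (a : F) :
    ∃! r : F, ∃ q : SkewPoly δ, f = q * (X - C a) + C r := by
  refine existsUnique_of_exists_of_unique ?_ ?_
  · induction f using induction_on with
    | h0 => exact ⟨0, 0, by simp [C]⟩
    | hadd f g hf hg =>
      obtain ⟨r, q, rfl⟩ := hf
      obtain ⟨r', q', rfl⟩ := hg
      exact ⟨r + r', q + q', by rw [add_mul, C_add]; abel⟩
    | hmon i b =>
      have h : ∃ r : F, ∃ q : SkewPoly δ, X ^ i = q * (X - C a) + C r := by
        induction i with
        | zero => exact ⟨1, 0, by rw [pow_zero, zero_mul, zero_add]; rfl⟩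
        | succ i ih =>
          obtain ⟨r, q, h⟩ := ih
          refine ⟨σ r * a + δ r, X * q + C (σ r), ?_⟩
          rw [pow_succ', h, mul_add, X_mul_C, C_add, ← C_mul_C, add_mul, mul_sub (C (σ r)),
            mul_assoc]
          abel
      obtain ⟨r, q, h⟩ := h
      exact ⟨b * r, C b * q, by rw [monomial_eq, h, mul_add, mul_assoc, C_mul_C]⟩
  · let T : AddMonoid.End F :=
      (AddMonoidHom.mulRight a).comp σ.toAddMonoidHom + δ.toAddMonoidHom
    have hT1 : ∀ c, T c = σ c * a + δ c := fun _ => rfl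
    have hT : ∀ c m : F, T (c • m) = σ c • T m + δ c • m := fun c m => by
      simp only [hT1, smul_eq_mul, map_mul, δ.leibniz, mul_add, mul_assoc, add_assoc]
    have hC : ∀ r : F, act (δ := δ) T (C r) 1 = r := fun r => by
      rw [C, act_monomial, pow_zero]; exact mul_one r
    have key : ∀ (q : SkewPoly δ) (r : F), act T (q * (X - C a) + C r) 1 = r := fun q r => by
      rw [map_add, end_add_apply, act_mul T hT, hC, map_sub]
      have : (act (δ := δ) T X - act (δ := δ) T (C a)) 1 = 0 := by
        change act (δ := δ) T X 1 - act (δ := δ) T (C a) 1 = 0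
        rw [hC, X, act_monomial, one_smul, pow_one, hT1, map_one, one_mul, δ.map_one, add_zero,
          sub_self]
      rw [this, map_zero, zero_add]
    rintro r r' ⟨q, h⟩ ⟨q', h'⟩
    rw [← key q r, ← h, h', key]

/-- The right evaluation `f(a)`: the unique remainder upon right division of `f` by `x - a`. -/
noncomputable def rightEval (f : SkewPoly δ) (a : F) : F :=
  (existsUnique_remainder f a).exists.choose

theorem rightEval_spec (f : SkewPoly δ) (a : F) :
    ∃ q : SkewPoly δ, f = q * (X - C a) + C (rightEval f a) :=
  (existsUnique_remainder f a).exists.choose_spec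

/-- `C_{d,s}(a)`: the sum of all possible compositions of `d` copies of `δ` and `s` copies of `σ`,
evaluated at `a`. The compositions are indexed by the words `w` of length `d + s` having exactly
`d` letters `true` (for `δ`); the product in `AddMonoid.End F` is composition of maps. -/
noncomputable def comps (δ : SkewDerivation σ) (d s : ℕ) (a : F) : F :=
  ∑ w : Fin (d + s) → Bool with (Finset.univ.filter fun i => w i = true).card = d,
    (List.ofFn fun i => (if w i = true then δ.toAddMonoidHom else σ.toAddMonoidHom :
      AddMonoid.End F)).prod a

/-- The entry in column `q` of the `p`-th Sylvester row of `f`: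
`∑ l, C_{p-l,l}(a_{q-l})` over `0 ≤ l ≤ p` with `l ≤ q`, where `a_j` is the `j`-th coefficient of
`f` (which is `0` for `j > deg f`). -/
noncomputable def sylvesterEntry (f : SkewPoly δ) (p q : ℕ) : F :=
  ∑ l ∈ Finset.range (p + 1), if l ≤ q then comps δ (p - l) l (f.coeff (q - l)) else 0

/-- The right `(σ, δ)`-Sylvester matrix of `f` and `g`, of degrees `m` and `n`: its first `n` rows
come from `f` and its last `m` rows come from `g`. -/
noncomputable def sylvester (f g : SkewPoly δ) :
    Matrix (Fin (g.natDegree + f.natDegree)) (Fin (g.natDegree + f.natDegree)) F :=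
  Matrix.of fun r q =>
    Fin.addCases (fun p : Fin g.natDegree => sylvesterEntry f p q)
      (fun p : Fin f.natDegree => sylvesterEntry g p q) r

/-- The elements `N_i(a)` with `N_0(a) = 1` and `N_{i+1}(a) = σ(N_i(a)) a + δ(N_i(a))`. -/
def truncNorm (δ : SkewDerivation σ) (a : F) : ℕ → F
  | 0 => 1
  | i + 1 => σ (truncNorm δ a i) * a + δ (truncNorm δ a i)

end SkewPoly

namespace Dieudonne

variable {F : Type*} [DivisionRing F]

open Classical in
/-- The class of `a : F` modulo `[F^*, F^*]` in `{0} ∪ F^* / [F^*, F^*]`. -/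
noncomputable def cls (a : F) : WithZero (Abelianization Fˣ) :=
  if h : a = 0 then 0 else ((Abelianization.of (Units.mk0 a h) : Abelianization Fˣ) : WithZero _)

open Classical in
/-- The Dieudonné determinant, with values in `{0} ∪ F^* / [F^*, F^*]`, computed by Gaussian
elimination with left row operations. The empty matrix has determinant `1`, and a matrix whose
column `0` vanishes has determinant `0`. Otherwise let `i` be the first row with `A i 0 ≠ 0`:
moving row `i` to the top contributes `(-1) ^ i`, then the multiple `A r 0 * (A i 0)⁻¹` of row `i`
is subtracted from every other row `r`, and the result is the class of the pivot times the
determinant of the remaining block. -/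
noncomputable def ddet : (k : ℕ) → Matrix (Fin k) (Fin k) F → WithZero (Abelianization Fˣ)
  | 0, _ => 1
  | k + 1, A =>
    if h : ∃ i, A i 0 ≠ 0 then
      let i := Fin.find (fun i => A i 0 ≠ 0) h
      cls ((-1) ^ (i : ℕ) * A i 0) *
        ddet k (Matrix.of fun r s : Fin k =>
          A (i.succAbove r) s.succ - A (i.succAbove r) 0 * (A i 0)⁻¹ * A i s.succ)
    else 0

end Dieudonne

/-- The right `(σ, δ)`-resultant: the Dieudonné determinant of the right Sylvester matrix. -/
noncomputable def SkewPoly.rightResultant {F : Type*} [DivisionRing F] {σ : F →+* F}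
    {δ : SkewDerivation σ} (f g : SkewPoly δ) : WithZero (Abelianization Fˣ) :=
  Dieudonne.ddet _ (SkewPoly.sylvester f g)

/-! ### Row operations on the Dieudonné determinant. -/

namespace Dieudonne

variable {F : Type*} [DivisionRing F]

/-! The rows of the Sylvester matrix are the coefficient vectors of `x ^ p * f` and `x ^ p * g`
(`sylvesterEntry_eq_coeff`): the sums of words in `σ` and `δ` satisfy the Pascal-type recursion
imposed by `x a = σ(a) x + δ(a)`. Each claim thus becomes a row operation. Exchanging `f` and `g`
rotates the rows, with sign `(-1) ^ (m * n)`; negating `f`, or multiplying it by `c` when `δ = 0`,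
scales its rows by `-1` or `σ^p(c)`. For constant `g` the matrix is lower triangular. For `g = x -
a`, right division lets the rows of `g` reduce the row of `f` to `(f(a), 0, …, 0)`, leaving a
triangular matrix with determinant the class of `f(a)`, for every `a`.

The remaining task is to show that `ddet`, defined by elimination on the first available pivot,
obeys the usual row rules. Changing the pivot alters the Schur complement by row operations of
smaller size, so transvection invariance and the adjacent swap rule are proved together by induction
on the size. Commutativity of the value monoid is what makes the resulting factors agree. -/

theorem cls_zero : cls (0 : F) = 0 := dif_pos rfl

theorem cls_of_ne_zero {a : F} (h : a ≠ 0) :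
    cls a = ((Abelianization.of (Units.mk0 a h) : Abelianization Fˣ) : WithZero _) := dif_neg h

theorem cls_one : cls (1 : F) = 1 := by
  rw [cls_of_ne_zero one_ne_zero, Units.mk0_one, map_one, WithZero.coe_one]

theorem cls_eq_zero {a : F} : cls a = 0 ↔ a = 0 := by
  refine ⟨fun h => ?_, fun h => h ▸ cls_zero⟩
  by_contra ha
  exact WithZero.coe_ne_zero ((cls_of_ne_zero ha).symm.trans h)

theorem cls_mul (a b : F) : cls (a * b) = cls a * cls b := by
  by_cases ha : a = 0
  · simp [ha, cls_zero]
  by_cases hb : b = 0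
  · simp [hb, cls_zero]
  rw [cls_of_ne_zero ha, cls_of_ne_zero hb, cls_of_ne_zero (mul_ne_zero ha hb), ← WithZero.coe_mul,
    ← map_mul]
  congr 2
  exact Units.ext rfl

/-- The class map as a homomorphism of monoids with zero. -/
noncomputable def clsHom : F →*₀ WithZero (Abelianization Fˣ) where
  toFun := cls
  map_zero' := cls_zero
  map_one' := cls_one
  map_mul' := cls_mul

theorem cls_pow (a : F) (n : ℕ) : cls (a ^ n) = cls a ^ n := map_pow clsHom a n

theorem cls_neg_one_sq : cls (-1 : F) * cls (-1) = 1 := by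
  rw [← cls_mul, neg_one_mul, neg_neg, cls_one]

/-- The Schur complement of the entry `A i 0` in `A`. -/
def pivotBlock {k : ℕ} (A : Matrix (Fin (k + 1)) (Fin (k + 1)) F) (i : Fin (k + 1)) :
    Matrix (Fin k) (Fin k) F :=
  Matrix.of fun r s => A (i.succAbove r) s.succ - A (i.succAbove r) 0 * (A i 0)⁻¹ * A i s.succ

theorem pivotBlock_apply {k : ℕ} (A : Matrix (Fin (k + 1)) (Fin (k + 1)) F) (i : Fin (k + 1))
    (r s : Fin k) : pivotBlock A i r s =
      A (i.succAbove r) s.succ - A (i.succAbove r) 0 * (A i 0)⁻¹ * A i s.succ := rfl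

theorem ddet_zero (A : Matrix (Fin 0) (Fin 0) F) : ddet 0 A = 1 := rfl

theorem ddet_of_col_zero {k : ℕ} (A : Matrix (Fin (k + 1)) (Fin (k + 1)) F)
    (h : ∀ i, A i 0 = 0) : ddet (k + 1) A = 0 := by
  rw [ddet, dif_neg (by simpa using h)]

theorem ddet_of_first_pivot {k : ℕ} (A : Matrix (Fin (k + 1)) (Fin (k + 1)) F) (i : Fin (k + 1))
    (hi : A i 0 ≠ 0) (hlt : ∀ j < i, A j 0 = 0) :
    ddet (k + 1) A = cls ((-1) ^ (i : ℕ) * A i 0) * ddet k (pivotBlock A i) := by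
  classical
  have h : ∃ i, A i 0 ≠ 0 := ⟨i, hi⟩
  have hfind : Fin.find (fun i => A i 0 ≠ 0) h = i :=
    (Fin.find_eq_iff h).2 ⟨hi, fun j hj => not_not.2 (hlt j hj)⟩
  rw [ddet, dif_pos h]
  -- Quantifying over `j` lets the pivot index be replaced in the sign, the entry and the block at
  -- once, and leaves only an equality of indices for `convert`.
  have key : ∀ j, j = i → cls ((-1) ^ (j : ℕ) * A j 0) * ddet k (pivotBlock A j) =
      cls ((-1) ^ (i : ℕ) * A i 0) * ddet k (pivotBlock A i) := by rintro _ rfl; rfl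
  refine key _ ?_
  convert hfind

theorem exists_first_pivot {k : ℕ} (A : Matrix (Fin (k + 1)) (Fin (k + 1)) F)
    (h : ∃ i, A i 0 ≠ 0) : ∃ i, A i 0 ≠ 0 ∧ ∀ j < i, A j 0 = 0 := by
  classical
  exact ⟨Fin.find _ h, Fin.find_spec h, fun j hj => not_not.1 (Fin.find_min h hj)⟩

/-- Nonzero left factors do not move the first pivot, and in the Schur complement the factor of the
pivot row cancels against its inverse, so the block is scaled by the remaining factors. -/
theorem ddet_scale : ∀ {k : ℕ} (A : Matrix (Fin k) (Fin k) F) (c : Fin k → F) (_ : ∀ r, c r ≠ 0),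
    ddet k (Matrix.of fun r s => c r * A r s) = (∏ r, cls (c r)) * ddet k A
  | 0, A, c, _ => by simp [ddet_zero]
  | k + 1, A, c, hc => by
    by_cases h : ∃ i, A i 0 ≠ 0
    · obtain ⟨i, hi, hlt⟩ := exists_first_pivot A h
      have hB : pivotBlock (Matrix.of fun r s => c r * A r s) i =
          Matrix.of fun r s => c (i.succAbove r) * pivotBlock A i r s := by
        ext r s
        simp only [pivotBlock_apply, Matrix.of_apply, mul_inv_rev, mul_sub]
        congr 1
        simp only [mul_assoc]
        rw [inv_mul_cancel_left₀ (hc i)]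
      rw [ddet_of_first_pivot A i hi hlt, ddet_of_first_pivot _ i
        (by simpa using ⟨hc i, hi⟩) (fun j hj => by simp [hlt j hj]), hB,
        ddet_scale _ _ (fun r => hc _), Fin.prod_univ_succAbove _ i]
      simp only [Matrix.of_apply, cls_mul]
      ac_rfl
    · push Not at h
      rw [ddet_of_col_zero A h, ddet_of_col_zero _ (fun i => by simp [h i]), mul_zero]

/-- Invariance of `ddet` under adding left multiples of one row to the other rows. -/
def TransvectionInvariant (F : Type*) [DivisionRing F] (k : ℕ) : Prop :=
  ∀ (A : Matrix (Fin k) (Fin k) F) (j : Fin k) (c : Fin k → F), c j = 0 →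
    ddet k (Matrix.of fun r s => A r s + c r * A j s) = ddet k A

/-- `ddet` changes by the class of `-1` when two adjacent rows are interchanged. -/
def AdjacentSwapRule (F : Type*) [DivisionRing F] (k : ℕ) : Prop :=
  ∀ (A : Matrix (Fin k) (Fin k) F) (x y : Fin k), (y : ℕ) = x + 1 →
    ddet k (A.submatrix (Equiv.swap x y) id) = cls (-1) * ddet k A

/-- `ddet` can be expanded along any nonzero entry of the first column. -/
def PivotRule (F : Type*) [DivisionRing F] (k : ℕ) : Prop :=
  ∀ (A : Matrix (Fin (k + 1)) (Fin (k + 1)) F) (i : Fin (k + 1)), A i 0 ≠ 0 →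
    ddet (k + 1) A = cls ((-1) ^ (i : ℕ) * A i 0) * ddet k (pivotBlock A i)

/-- Adjacency is essential: only then does the swap carry the increasing enumeration of the
complement of `y` to that of the complement of `x`. -/
theorem succAbove_swap_adjacent {k : ℕ} {x y : Fin (k + 1)} (hxy : (y : ℕ) = x + 1) (r : Fin k) :
    Equiv.swap x y (y.succAbove r) = x.succAbove r := by
  rcases lt_trichotomy (r : ℕ) x with h | h | h
  · have h1 : y.succAbove r = r.castSucc := Fin.succAbove_of_castSucc_lt _ _ (by
      rw [Fin.lt_def]; simp; omega)
    have h2 : x.succAbove r = r.castSucc := Fin.succAbove_of_castSucc_lt _ _ (by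
      rw [Fin.lt_def]; simp; omega)
    rw [h1, h2, Equiv.swap_apply_of_ne_of_ne] <;> rw [Ne, Fin.ext_iff] <;> simp <;> omega
  · have h1 : y.succAbove r = x := by
      rw [Fin.succAbove_of_castSucc_lt _ _ (by rw [Fin.lt_def]; simp; omega)]
      exact Fin.ext (by simpa using h)
    have h2 : x.succAbove r = y := by
      rw [Fin.succAbove_of_le_castSucc _ _ (by rw [Fin.le_def]; simp; omega)]
      exact Fin.ext (by simp; omega)
    rw [h1, h2, Equiv.swap_apply_left]
  · have h1 : y.succAbove r = r.succ := Fin.succAbove_of_le_castSucc _ _ (by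
      rw [Fin.le_def]; simp; omega)
    have h2 : x.succAbove r = r.succ := Fin.succAbove_of_le_castSucc _ _ (by
      rw [Fin.le_def]; simp; omega)
    rw [h1, h2, Equiv.swap_apply_of_ne_of_ne] <;> rw [Ne, Fin.ext_iff] <;> simp <;> omega

theorem succAbove_swap_adjacent' {k : ℕ} {x y : Fin (k + 1)} (hxy : (y : ℕ) = x + 1) (r : Fin k) :
    Equiv.swap x y (x.succAbove r) = y.succAbove r := by
  rw [← succAbove_swap_adjacent hxy, Equiv.swap_apply_self]

theorem pivotBlock_submatrix_swap_left {k : ℕ} (A : Matrix (Fin (k + 1)) (Fin (k + 1)) F)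
    {x y : Fin (k + 1)} (hxy : (y : ℕ) = x + 1) :
    pivotBlock (A.submatrix (Equiv.swap x y) id) x = pivotBlock A y := by
  ext r s
  simp [pivotBlock_apply, succAbove_swap_adjacent' hxy]

theorem pivotBlock_submatrix_swap_right {k : ℕ} (A : Matrix (Fin (k + 1)) (Fin (k + 1)) F)
    {x y : Fin (k + 1)} (hxy : (y : ℕ) = x + 1) :
    pivotBlock (A.submatrix (Equiv.swap x y) id) y = pivotBlock A x := by
  ext r s
  simp [pivotBlock_apply, succAbove_swap_adjacent hxy]

/-- The case split is on the first pivot `i` of `A`. The hard case is `i = x` with `A y 0 ≠ 0`,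
where the swap changes which row serves as pivot; otherwise either the same row is the pivot,
displaced by one place, or the swap takes place inside the Schur complement. -/
theorem adjacentSwapRule_succ {k : ℕ} (hT : TransvectionInvariant F k)
    (hS : AdjacentSwapRule F k) : AdjacentSwapRule F (k + 1) := by
  intro A x y hxy
  have hne : x ≠ y := fun h => by rw [h] at hxy; omega
  by_cases h : ∃ i, A i 0 ≠ 0
  swap
  · push Not at h
    rw [ddet_of_col_zero A h, ddet_of_col_zero _ (fun i => by simp [h]), mul_zero]
  obtain ⟨i, hi, hlt⟩ := exists_first_pivot A h
  rw [ddet_of_first_pivot A i hi hlt]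
  by_cases hix : i = x
  · subst hix
    by_cases hy : A y 0 = 0
    · rw [ddet_of_first_pivot _ y (by simpa using hi), pivotBlock_submatrix_swap_right A hxy,
        ← mul_assoc, ← cls_mul, hxy, pow_succ']
      · simp
      · intro j hj
        rcases eq_or_ne j i with rfl | hji
        · simpa using hy
        · have : j < i := by
            rw [Fin.lt_def] at hj ⊢
            have := Fin.val_ne_of_ne hji
            omega
          simpa [Equiv.swap_apply_of_ne_of_ne hji hj.ne] using hlt j this
    · obtain ⟨u, hu⟩ := Fin.exists_succAbove_eq hne.symm
      -- Write `R_u` for row `u` of `pivotBlock A i`, which comes from row `y` of `A`. Pivoting on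
      -- `y` instead turns `R_u` into `-(A i 0 * (A y 0)⁻¹) * R_u` and subtracts `A r 0 * (A y 0)⁻¹
      -- * R_u` from each other row, with `r` its index in `A`.
      have hB : pivotBlock A y = Matrix.of fun r s =>
          (if r = u then -(A i 0 * (A y 0)⁻¹) else 1) *
          (Matrix.of fun r s => pivotBlock A i r s +
            (if r = u then 0 else -(A (i.succAbove r) 0 * (A y 0)⁻¹)) * pivotBlock A i u s) r s := by
        ext r s
        by_cases hr : r = u
        · subst hr
          have : y.succAbove r = i := by
            rw [← succAbove_swap_adjacent' hxy, hu, Equiv.swap_apply_right]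
          simp only [pivotBlock_apply, this, hu, Matrix.of_apply, if_true]
          rw [zero_mul, add_zero, neg_mul, mul_sub, neg_sub]
          simp only [mul_assoc]
          rw [inv_mul_cancel_left₀ hy, mul_inv_cancel_left₀ hi]
        · have : y.succAbove r = i.succAbove r := by
            rw [← succAbove_swap_adjacent' hxy, Equiv.swap_apply_of_ne_of_ne (Fin.succAbove_ne _ _)]
            rw [← hu]
            exact fun h => hr (Fin.succAbove_right_injective h)
          simp only [pivotBlock_apply, this, hu, Matrix.of_apply, if_neg hr, one_mul, mul_sub,
            neg_mul, mul_assoc]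
          rw [inv_mul_cancel_left₀ hy]
          abel
      rw [ddet_of_first_pivot _ i (by simpa using hy), pivotBlock_submatrix_swap_left A hxy,
        hB, ddet_scale, hT _ _ _ (if_pos rfl), ← mul_assoc, ← mul_assoc]
      · congr 1
        have : ∏ r, cls (if r = u then -(A i 0 * (A y 0)⁻¹) else 1) =
            cls (-(A i 0 * (A y 0)⁻¹)) := by
          rw [Finset.prod_eq_single u (fun b _ hb => by rw [if_neg hb, cls_one]) (by simp),
            if_pos rfl]
        -- With `a = A i 0` and `b = A y 0`, the class of `-(a b⁻¹)` times that of `b` is the class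
        -- of `-a`.
        rw [this, mul_comm, ← cls_mul, ← cls_mul]
        simp only [Matrix.submatrix_apply, Equiv.swap_apply_left, id]
        rw [cls_mul (-1), neg_eq_neg_one_mul (A i 0 * _), mul_assoc, cls_mul (-1)]
        congr 1
        rw [cls_mul, cls_mul, cls_mul, cls_mul]
        have : cls ((A y 0)⁻¹) * cls (A y 0) = 1 := by
          rw [← cls_mul, inv_mul_cancel₀ hy, cls_one]
        rw [mul_comm (cls (A i 0)), mul_mul_mul_comm, mul_comm _ (cls (A i 0)), ← mul_assoc,
          mul_right_comm, mul_right_comm (cls (A y 0)⁻¹), this, one_mul, mul_comm]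
      · intro r
        split_ifs
        · exact neg_ne_zero.2 (mul_ne_zero hi (inv_ne_zero hy))
        · exact one_ne_zero
      · intro j hj
        have h1 := hlt j hj
        have : j ≠ y := by
          rintro rfl
          rw [Fin.lt_def] at hj
          omega
        simpa [Equiv.swap_apply_of_ne_of_ne hj.ne this] using h1
  by_cases hiy : i = y
  · subst hiy
    rw [ddet_of_first_pivot _ x (by simpa using hi), pivotBlock_submatrix_swap_left A hxy,
      ← mul_assoc, ← cls_mul, hxy, pow_succ']
    · simp
    · intro j hj
      have hxi : x < i := by rw [Fin.lt_def]; omega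
      simpa [Equiv.swap_apply_of_ne_of_ne hj.ne (hj.trans hxi).ne] using hlt j (hj.trans hxi)
  · obtain ⟨u, hu⟩ := Fin.exists_succAbove_eq (Ne.symm hix)
    obtain ⟨v, hv⟩ := Fin.exists_succAbove_eq (Ne.symm hiy)
    -- The pivot row differs from `x` and `y` and cannot lie between them, so they stay adjacent
    -- after its removal.
    have huv : (v : ℕ) = u + 1 := by
      have h1 := congrArg Fin.val hu
      have h2 := congrArg Fin.val hv
      have h3 := Fin.val_ne_of_ne hix
      have h4 := Fin.val_ne_of_ne hiy
      simp only [Fin.succAbove, Fin.lt_def] at h1 h2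
      split_ifs at h1 h2 <;> simp at * <;> omega
    have hB : pivotBlock (A.submatrix (Equiv.swap x y) id) i =
        (pivotBlock A i).submatrix (Equiv.swap u v) id := by
      ext r s
      have : Equiv.swap x y (i.succAbove r) = i.succAbove (Equiv.swap u v r) := by
        rw [← hu, ← hv]
        exact Function.Injective.swap_apply Fin.succAbove_right_injective u v r
      simp [pivotBlock_apply, this, Equiv.swap_apply_of_ne_of_ne hix hiy]
    rw [ddet_of_first_pivot _ i (by simpa [Equiv.swap_apply_of_ne_of_ne hix hiy] using hi), hB,
      hS _ _ _ huv, mul_left_comm]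
    · simp [Equiv.swap_apply_of_ne_of_ne hix hiy]
    · intro j hj
      simp only [Matrix.submatrix_apply, id]
      apply hlt
      have h3 := Fin.val_ne_of_ne hix
      have h4 := Fin.val_ne_of_ne hiy
      rw [Fin.lt_def] at hj ⊢
      rw [Equiv.swap_apply_def]
      split_ifs with h1 h2
      · subst h1; omega
      · subst h2; omega
      · exact hj

/-- The chosen row is moved up one place at a time; each swap costs a class of `-1`, which is its
own inverse, and leaves the Schur complement unchanged. -/
theorem pivotRule_of_adjacentSwapRule {k : ℕ} (hS : AdjacentSwapRule F (k + 1)) :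
    PivotRule F k := by
  suffices ∀ (t : ℕ) (A : Matrix (Fin (k + 1)) (Fin (k + 1)) F) (i : Fin (k + 1)), (i : ℕ) = t →
      A i 0 ≠ 0 → ddet (k + 1) A = cls ((-1) ^ (i : ℕ) * A i 0) * ddet k (pivotBlock A i) from
    fun A i hi => this _ A i rfl hi
  intro t
  induction t with
  | zero =>
    intro A i h0 hi
    refine ddet_of_first_pivot A i hi fun j hj => ?_
    rw [Fin.lt_def] at hj
    omega
  | succ t ih =>
    intro A i ht hi
    let x : Fin (k + 1) := ⟨t, by omega⟩
    have hxi : (i : ℕ) = x + 1 := ht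
    have h1 := hS A x i hxi
    rw [ih _ x rfl (by simpa using hi), pivotBlock_submatrix_swap_left A hxi] at h1
    have h2 := congrArg (cls (-1 : F) * ·) h1
    simp only [← mul_assoc, cls_neg_one_sq, one_mul] at h2
    rw [← h2, ← cls_mul, hxi, pow_succ']
    simp [x]

/-- If `A j 0 ≠ 0`, pivoting on row `j` gives the same Schur complement before and after. If `A j 0
= 0`, the first column is unaffected, and with any other pivot the operation descends to a
transvection of the block. -/
theorem transvectionInvariant_succ {k : ℕ} (hT : TransvectionInvariant F k)
    (hP : PivotRule F k) : TransvectionInvariant F (k + 1) := by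
  intro A j c hc
  by_cases hj : A j 0 = 0
  swap
  · rw [hP A j hj, hP _ j (by simpa [hc] using hj)]
    have : pivotBlock (Matrix.of fun r s => A r s + c r * A j s) j = pivotBlock A j := by
      ext r s
      simp only [pivotBlock_apply, Matrix.of_apply, hc, zero_mul, add_zero, add_mul]
      rw [mul_assoc (c _), mul_inv_cancel₀ hj, mul_one]
      abel
    rw [this]
    simp [hc]
  by_cases h : ∃ i, A i 0 ≠ 0
  swap
  · push Not at h
    rw [ddet_of_col_zero A h, ddet_of_col_zero _ (fun i => by simp [h])]
  obtain ⟨i, hi⟩ := h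
  have hji : j ≠ i := by rintro rfl; exact hi hj
  obtain ⟨u, hu⟩ := Fin.exists_succAbove_eq hji
  rw [hP A i hi, hP _ i (by simpa [hj] using hi)]
  have : pivotBlock (Matrix.of fun r s => A r s + c r * A j s) i =
      Matrix.of fun r s => pivotBlock A i r s +
        (c (i.succAbove r) - A (i.succAbove r) 0 * (A i 0)⁻¹ * c i) * pivotBlock A i u s := by
    ext r s
    simp only [pivotBlock_apply, Matrix.of_apply, hu, hj, mul_zero, add_zero, zero_mul, sub_zero,
      mul_add, sub_mul, mul_assoc]
    abel
  rw [this, hT _ _ _ (by rw [hu, hc, hj]; simp)]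
  simp [hj]

theorem transvectionInvariant_and_adjacentSwapRule (k : ℕ) :
    TransvectionInvariant F k ∧ AdjacentSwapRule F k := by
  induction k with
  | zero => exact ⟨fun A j => j.elim0, fun A j => j.elim0⟩
  | succ k ih =>
    have hS := adjacentSwapRule_succ ih.1 ih.2
    exact ⟨transvectionInvariant_succ ih.1 (pivotRule_of_adjacentSwapRule hS), hS⟩

theorem ddet_add_row_mul {k : ℕ} (A : Matrix (Fin k) (Fin k) F) (j : Fin k) (c : Fin k → F)
    (hc : c j = 0) : ddet k (Matrix.of fun r s => A r s + c r * A j s) = ddet k A :=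
  (transvectionInvariant_and_adjacentSwapRule k).1 A j c hc

/-- Adjacent transpositions generate the symmetric group, and the sign is multiplicative. -/
theorem ddet_permute {k : ℕ} (A : Matrix (Fin k) (Fin k) F) (π : Equiv.Perm (Fin k)) :
    ddet k (A.submatrix π id) = cls ((Equiv.Perm.sign π : ℤ) : F) * ddet k A := by
  obtain _ | k := k
  · simp [ddet_zero, Subsingleton.elim π 1, cls_one]
  have hπ : π ∈ Submonoid.closure
      (Set.range fun i : Fin k ↦ Equiv.swap i.castSucc i.succ) := by
    rw [Equiv.Perm.mclosure_swap_castSucc_succ]; trivial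
  induction hπ using Submonoid.closure_induction generalizing A with
  | mem π h =>
    obtain ⟨i, rfl⟩ := h
    rw [(transvectionInvariant_and_adjacentSwapRule (k + 1)).2 A _ _ (by simp),
      Equiv.Perm.sign_swap (Fin.castSucc_lt_succ).ne]
    simp
  | one => simp [cls_one]
  | mul π τ _ _ h1 h2 =>
    have : A.submatrix (π * τ) id = (A.submatrix π id).submatrix τ id := rfl
    rw [this, h2, h1, ← mul_assoc, ← cls_mul, map_mul, mul_comm (Equiv.Perm.sign π)]
    push_cast
    rfl

theorem ddet_of_row_zero : ∀ {k : ℕ} (A : Matrix (Fin k) (Fin k) F) (j : Fin k)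
    (_ : ∀ s, A j s = 0), ddet k A = 0
  | 0, _, j, _ => j.elim0
  | k + 1, A, j, hj => by
    by_cases h : ∃ i, A i 0 ≠ 0
    · obtain ⟨i, hi, hlt⟩ := exists_first_pivot A h
      have hji : j ≠ i := by rintro rfl; exact hi (hj 0)
      obtain ⟨u, hu⟩ := Fin.exists_succAbove_eq hji
      rw [ddet_of_first_pivot A i hi hlt,
        ddet_of_row_zero _ u (fun s => by simp [pivotBlock_apply, hu, hj]), mul_zero]
    · push Not at h
      exact ddet_of_col_zero A h

/-- The first row vanishes off the diagonal, so elimination with it leaves the remaining block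
untouched; if `A 0 0 = 0` the whole row is zero. -/
theorem ddet_of_lowerTriangular : ∀ {k : ℕ} (A : Matrix (Fin k) (Fin k) F)
    (_ : ∀ i j, i < j → A i j = 0), ddet k A = ∏ i, cls (A i i)
  | 0, A, _ => by simp [ddet_zero]
  | k + 1, A, hA => by
    by_cases h : A 0 0 = 0
    · rw [ddet_of_row_zero A 0, Fin.prod_univ_succ, h, cls_zero, zero_mul]
      intro s
      rcases eq_or_ne s 0 with rfl | hs
      · exact h
      · exact hA 0 s (Fin.pos_iff_ne_zero.2 hs)
    · have hB : ∀ r s, pivotBlock A 0 r s = A r.succ s.succ := fun r s => by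
        simp [pivotBlock_apply, hA 0 s.succ (Fin.succ_pos s)]
      rw [ddet_of_first_pivot A 0 h (fun j hj => absurd hj (Fin.not_lt_zero j)),
        ddet_of_lowerTriangular _ (fun i j hij => by
          rw [hB]; exact hA _ _ (Fin.succ_lt_succ_iff.2 hij)), Fin.prod_univ_succ]
      simp [hB]

theorem ddet_add_row_sum {k : ℕ} (A : Matrix (Fin k) (Fin k) F) (i : Fin k) (c : Fin k → F)
    (S : Finset (Fin k)) (hS : i ∉ S) :
    ddet k (Matrix.of fun r s => if r = i then A i s + ∑ j ∈ S, c j * A j s else A r s) =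
      ddet k A := by
  induction S using Finset.induction_on with
  | empty =>
    congr 1
    ext r s
    by_cases hr : r = i <;> simp [hr]
  | insert j S hj ih =>
    rw [Finset.mem_insert, not_or] at hS
    rw [← ih hS.2, ← ddet_add_row_mul (Matrix.of fun r s =>
      if r = i then A i s + ∑ j ∈ S, c j * A j s else A r s) j
      (fun r => if r = i then c j else 0) (if_neg (Ne.symm hS.1))]
    congr 1
    ext r s
    by_cases hr : r = i
    · simp only [hr, Matrix.of_apply, if_true, if_neg (Ne.symm hS.1), Finset.sum_insert hj]
      abel
    · simp [hr]

end Dieudonne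

/-! ### Coefficients and degrees of skew polynomials. -/

namespace SkewPoly

variable {F : Type*} [DivisionRing F] {σ : F →+* F} {δ : SkewDerivation σ}

@[ext]
theorem ext {f g : SkewPoly δ} (h : ∀ i, f.coeff i = g.coeff i) : f = g :=
  Finsupp.ext (M := F) h

theorem coeff_zero (i : ℕ) : (0 : SkewPoly δ).coeff i = 0 := rfl

theorem coeff_add (f g : SkewPoly δ) (i : ℕ) : (f + g).coeff i = f.coeff i + g.coeff i := rfl

theorem coeff_neg (f : SkewPoly δ) (i : ℕ) : (-f).coeff i = -f.coeff i := rfl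

theorem coeff_smul (a : F) (f : SkewPoly δ) (i : ℕ) : (a • f).coeff i = a * f.coeff i := rfl

theorem coeff_monomial (i : ℕ) (a : F) (j : ℕ) :
    (monomial i a : SkewPoly δ).coeff j = if i = j then a else 0 :=
  Finsupp.single_apply (M := F)

theorem coeff_C (a : F) (j : ℕ) : (C a : SkewPoly δ).coeff j = if 0 = j then a else 0 :=
  coeff_monomial 0 a j

/-- The `i`-th coefficient, as an additive map. -/
def coeffHom (i : ℕ) : SkewPoly δ →+ F where
  toFun f := f.coeff i
  map_zero' := rfl
  map_add' _ _ := rfl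

theorem coeff_sub (f g : SkewPoly δ) (i : ℕ) : (f - g).coeff i = f.coeff i - g.coeff i :=
  map_sub (coeffHom i) f g

theorem coeff_sum {ι : Type*} (s : Finset ι) (f : ι → SkewPoly δ) (i : ℕ) :
    (∑ j ∈ s, f j).coeff i = ∑ j ∈ s, (f j).coeff i :=
  map_sum (coeffHom i) f s

theorem coeff_eq_zero_of_natDegree_lt {f : SkewPoly δ} {i : ℕ} (h : f.natDegree < i) :
    f.coeff i = 0 := by
  by_contra hi
  have : i ∈ Finsupp.support (M := F) f := Finsupp.mem_support_iff.2 hi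
  exact absurd (Finset.le_sup (f := id) this) (not_le.2 h)

theorem coeff_natDegree_ne_zero {f : SkewPoly δ} (h : f ≠ 0) : f.coeff f.natDegree ≠ 0 := by
  have hne : (Finsupp.support (M := F) f).Nonempty := Finsupp.support_nonempty_iff.2 h
  obtain ⟨i, hi, hi'⟩ := Finset.exists_mem_eq_sup _ hne id
  have : f.natDegree = i := hi'
  rw [this]
  exact Finsupp.mem_support_iff.1 hi

theorem natDegree_congr {f g : SkewPoly δ} (h : ∀ i, f.coeff i = 0 ↔ g.coeff i = 0) :
    f.natDegree = g.natDegree := by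
  have : Finsupp.support (M := F) f = Finsupp.support (M := F) g := by
    ext i
    exact Finsupp.mem_support_iff.trans ((not_congr (h i)).trans Finsupp.mem_support_iff.symm)
  exact congrArg (fun s : Finset ℕ => s.sup id) this

theorem natDegree_neg (f : SkewPoly δ) : (-f).natDegree = f.natDegree :=
  natDegree_congr fun i => by rw [coeff_neg, neg_eq_zero]

theorem natDegree_C_mul {c : F} (hc : c ≠ 0) (f : SkewPoly δ) :
    (C c * f).natDegree = f.natDegree :=
  natDegree_congr fun i => by rw [C_mul, coeff_smul, mul_eq_zero, or_iff_right hc]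

theorem natDegree_eq_of_coeff {f : SkewPoly δ} {d : ℕ} (h : f.coeff d ≠ 0)
    (h' : ∀ i, d < i → f.coeff i = 0) : f.natDegree = d := by
  apply le_antisymm
  · by_contra hlt
    have hf : f ≠ 0 := fun h0 => h (by rw [h0, coeff_zero])
    exact coeff_natDegree_ne_zero hf (h' _ (not_le.1 hlt))
  · by_contra hlt
    exact h (coeff_eq_zero_of_natDegree_lt (not_le.1 hlt))

theorem eq_sum_monomial {f : SkewPoly δ} {n : ℕ} (h : ∀ i, n ≤ i → f.coeff i = 0) :
    f = ∑ i ∈ Finset.range n, monomial i (f.coeff i) := by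
  ext j
  rw [coeff_sum]
  simp only [coeff_monomial, Finset.sum_ite_eq', Finset.mem_range]
  split_ifs with hj
  · rfl
  · exact h j (not_lt.1 hj)

/-! ### Left multiplication by `x` and words in `σ` and `δ`. -/

theorem coeff_xMul_zero (f : SkewPoly δ) : (xMul δ f).coeff 0 = δ (f.coeff 0) := by
  induction f using induction_on with
  | h0 => simp [coeff_zero]
  | hadd f g hf hg => simp only [map_add, coeff_add, hf, hg]
  | hmon i b =>
    rw [xMul_monomial, coeff_add, coeff_monomial, coeff_monomial, coeff_monomial]
    by_cases h : i = 0 <;> simp [h]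

theorem coeff_xMul_succ (f : SkewPoly δ) (q : ℕ) :
    (xMul δ f).coeff (q + 1) = σ (f.coeff q) + δ (f.coeff (q + 1)) := by
  induction f using induction_on with
  | h0 => simp [coeff_zero]
  | hadd f g hf hg => simp only [map_add, coeff_add, hf, hg]; abel
  | hmon i b =>
    rw [xMul_monomial, coeff_add, coeff_monomial, coeff_monomial, coeff_monomial, coeff_monomial]
    by_cases h : i = q
    · simp [h]
    · by_cases h' : i = q + 1 <;> simp [h, h']

theorem xMul_pow_succ (p : ℕ) (f : SkewPoly δ) :
    (xMul δ ^ (p + 1)) f = xMul δ ((xMul δ ^ p) f) := by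
  rw [pow_succ']; rfl

/-- The sum of all compositions of `N` maps among which `s` are `σ` and the others `δ`. -/
noncomputable def wordSum (δ : SkewDerivation σ) (N s : ℕ) (a : F) : F :=
  ∑ w : Fin N → Bool with (Finset.univ.filter fun i => w i = false).card = s,
    (List.ofFn fun i => (if w i = true then δ.toAddMonoidHom else σ.toAddMonoidHom :
      AddMonoid.End F)).prod a

/-- Indexing by total length and number of `σ`'s allows induction on the length and removes the
truncated subtraction in `comps δ (p - l) l`. -/
theorem comps_eq_wordSum (d s : ℕ) (a : F) : comps δ d s a = wordSum δ (d + s) s a := by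
  unfold comps wordSum
  congr 1
  ext w
  simp only [Finset.mem_filter, Finset.mem_univ, true_and]
  have h := Finset.card_filter_add_card_filter_not (s := (Finset.univ : Finset (Fin (d + s))))
    (fun i => w i = true)
  simp only [Bool.not_eq_true, Finset.card_univ, Fintype.card_fin] at h
  omega

theorem wordSum_eq_zero_of_lt {N s : ℕ} (h : N < s) (a : F) : wordSum δ N s a = 0 := by
  unfold wordSum
  rw [Finset.filter_eq_empty_iff.2, Finset.sum_empty]
  intro w _ hw
  have := Finset.card_le_univ (Finset.univ.filter fun i => w i = false)
  rw [hw, Fintype.card_fin] at this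
  omega

theorem wordSum_zero_zero (a : F) : wordSum δ 0 0 a = a := by
  simp [wordSum]

/-- Words are split by their first letter, the outermost map. The condition `card + 1 = s`, rather
than `card = s - 1`, makes the `σ` part empty for `s = 0`. -/
theorem wordSum_succ_aux (N s : ℕ) (a : F) : wordSum δ (N + 1) s a =
    δ (wordSum δ N s a) + σ (∑ w : Fin N → Bool with
      (Finset.univ.filter fun i => w i = false).card + 1 = s,
    (List.ofFn fun i => (if w i = true then δ.toAddMonoidHom else σ.toAddMonoidHom :
      AddMonoid.End F)).prod a) := by
  unfold wordSum
  rw [Finset.sum_filter, ← (Fin.consEquiv fun _ => Bool).sum_comp, Fintype.sum_prod_type,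
    Fintype.sum_bool, map_sum, map_sum, Finset.sum_filter, Finset.sum_filter]
  congr 1 <;> refine Finset.sum_congr rfl fun w _ => ?_
  · simp only [Fin.consEquiv_apply, Fin.card_filter_univ_succ, List.ofFn_succ, Fin.cons_zero,
      Fin.cons_succ, List.prod_cons, Bool.true_eq_false, if_false]
    rfl
  · simp only [Fin.consEquiv_apply, Fin.card_filter_univ_succ, List.ofFn_succ, Fin.cons_zero,
      Fin.cons_succ, if_true, List.prod_cons, Bool.false_eq_true]
    rfl

theorem wordSum_succ_zero (N : ℕ) (a : F) : wordSum δ (N + 1) 0 a = δ (wordSum δ N 0 a) := by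
  simp [wordSum_succ_aux]

theorem wordSum_succ_succ (N s : ℕ) (a : F) :
    wordSum δ (N + 1) (s + 1) a = δ (wordSum δ N (s + 1) a) + σ (wordSum δ N s a) := by
  rw [wordSum_succ_aux]
  simp only [Nat.add_right_cancel_iff]
  rfl

theorem sylvesterEntry_eq_sum (f : SkewPoly δ) (p q : ℕ) :
    sylvesterEntry f p q = ∑ l ∈ Finset.range (q + 1), wordSum δ p l (f.coeff (q - l)) := by
  unfold sylvesterEntry
  rw [← Finset.sum_filter]
  have h1 : ∀ l ∈ (Finset.range (p + 1)).filter (· ≤ q),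
      comps δ (p - l) l (f.coeff (q - l)) = wordSum δ p l (f.coeff (q - l)) := fun l hl => by
    rw [Finset.mem_filter, Finset.mem_range] at hl
    rw [comps_eq_wordSum, Nat.sub_add_cancel (by omega)]
  rw [Finset.sum_congr rfl h1]
  refine Finset.sum_subset (fun l hl => ?_) (fun l hl hl' => wordSum_eq_zero_of_lt ?_ _)
  · rw [Finset.mem_filter] at hl
    exact Finset.mem_range.2 (by omega)
  · rw [Finset.mem_filter, Finset.mem_range] at hl'
    rw [Finset.mem_range] at hl
    omega

/-- The rows of the Sylvester matrix are the coefficient vectors of `x ^ p * f`. -/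
theorem sylvesterEntry_eq_coeff (f : SkewPoly δ) (p q : ℕ) :
    sylvesterEntry f p q = ((xMul δ ^ p) f).coeff q := by
  rw [sylvesterEntry_eq_sum]
  induction p generalizing q with
  | zero =>
    rw [Finset.sum_range_succ', Finset.sum_eq_zero fun l _ => wordSum_eq_zero_of_lt (by omega) _,
      wordSum_zero_zero, zero_add]
    rfl
  | succ p ih =>
    rw [xMul_pow_succ]
    cases q with
    | zero => rw [coeff_xMul_zero, ← ih, Finset.sum_range_one, Finset.sum_range_one, wordSum_succ_zero]
    | succ q =>
      -- The term `l = 0` has no `σ` and is split off; the others break into a `δ` part and a `σ`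
      -- part, which are the column `q + 1` and column `q` entries of the previous row.
      rw [coeff_xMul_succ, ← ih, ← ih, Finset.sum_range_succ']
      simp only [wordSum_succ_succ, wordSum_succ_zero, Nat.add_sub_add_right, map_sum,
        Finset.sum_add_distrib]
      rw [Finset.sum_range_succ' _ (q + 1)]
      simp only [Nat.add_sub_add_right]
      abel

theorem coeff_xMul_pow_of_lt {f : SkewPoly δ} {d : ℕ} (h : ∀ i, d < i → f.coeff i = 0) (p : ℕ) :
    ∀ i, d + p < i → ((xMul δ ^ p) f).coeff i = 0 := by
  induction p with
  | zero => exact h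
  | succ p ih =>
    intro i hi
    obtain ⟨i, rfl⟩ : ∃ j, i = j + 1 := ⟨i - 1, by omega⟩
    rw [xMul_pow_succ, coeff_xMul_succ, ih i (by omega), ih (i + 1) (by omega)]
    simp

theorem coeff_xMul_pow_top {f : SkewPoly δ} {d : ℕ} (h : ∀ i, d < i → f.coeff i = 0) (p : ℕ) :
    ((xMul δ ^ p) f).coeff (d + p) = σ^[p] (f.coeff d) := by
  induction p with
  | zero => rfl
  | succ p ih =>
    rw [xMul_pow_succ, ← add_assoc, coeff_xMul_succ, ih,
      coeff_xMul_pow_of_lt h p _ (by omega), map_zero, add_zero, Function.iterate_succ_apply']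

theorem xMul_pow_smul_of_eq_zero (h : δ = 0) (c : F) (f : SkewPoly δ) (p : ℕ) :
    (xMul δ ^ p) (c • f) = σ^[p] c • (xMul δ ^ p) f := by
  induction p with
  | zero => rfl
  | succ p ih =>
    have h0 : ∀ a, δ a = 0 := fun a => by rw [h]; rfl
    rw [xMul_pow_succ, ih, xMul_smul, h0, zero_smul, add_zero, Function.iterate_succ_apply',
      xMul_pow_succ]

/-! ### Right division by `x - a` and the resultant matrix. -/

theorem coeff_X_sub_C_one (a : F) : (X - C a : SkewPoly δ).coeff 1 = 1 := by
  simp [X, coeff_sub, coeff_monomial, coeff_C]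

theorem coeff_X_sub_C_of_lt (a : F) (i : ℕ) (h : 1 < i) : (X - C a : SkewPoly δ).coeff i = 0 := by
  simp [X, coeff_sub, coeff_monomial, coeff_C, h.ne, (zero_lt_one.trans h).ne]

theorem natDegree_X_sub_C (a : F) : (X - C a : SkewPoly δ).natDegree = 1 :=
  natDegree_eq_of_coeff (by rw [coeff_X_sub_C_one]; exact one_ne_zero) (coeff_X_sub_C_of_lt a)

theorem mul_eq_sum {q : SkewPoly δ} {N : ℕ} (h : ∀ i, N ≤ i → q.coeff i = 0) (g : SkewPoly δ) :
    q * g = ∑ i ∈ Finset.range N, q.coeff i • (xMul δ ^ i) g := by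
  conv_lhs => rw [eq_sum_monomial h]
  rw [Finset.sum_mul]
  exact Finset.sum_congr rfl fun i _ => act_monomial _ _ _ _

/-- Right division by `x - a`, with a bound on the degree of the quotient. -/
theorem exists_eq_sum_add_rightEval (f : SkewPoly δ) (a : F) : ∃ c : ℕ → F,
    f = ∑ i ∈ Finset.range f.natDegree, c i • (xMul δ ^ i) (X - C a) + C (rightEval f a) := by
  obtain ⟨q, hq⟩ := rightEval_spec f a
  refine ⟨q.coeff, ?_⟩
  rw [← mul_eq_sum (fun i hi => ?_)]
  · exact hq
  by_cases hq0 : q = 0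
  · rw [hq0, coeff_zero]
  apply coeff_eq_zero_of_natDegree_lt
  refine lt_of_lt_of_le (lt_of_not_ge fun hlt => ?_) hi
  -- Since `x - a` is monic and `σ` fixes `1`, the coefficient of `q * (x - a)` at this index is the
  -- leading coefficient of `q`; the remainder only reaches index `0`.
  have h1 : f.coeff (q.natDegree + 1) = 0 := coeff_eq_zero_of_natDegree_lt (by omega)
  rw [hq, coeff_add, coeff_C, if_neg (by omega), add_zero,
    mul_eq_sum (N := q.natDegree + 1) (fun i hi => coeff_eq_zero_of_natDegree_lt hi), coeff_sum,
    Finset.sum_range_succ, Finset.sum_eq_zero, zero_add, coeff_smul, add_comm q.natDegree 1,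
    coeff_xMul_pow_top (coeff_X_sub_C_of_lt a), coeff_X_sub_C_one, iterate_map_one, mul_one] at h1
  · exact coeff_natDegree_ne_zero hq0 h1
  · intro i hi'
    rw [Finset.mem_range] at hi'
    rw [coeff_smul, coeff_xMul_pow_of_lt (coeff_X_sub_C_of_lt a) _ _ (by omega), mul_zero]

/-- The resultant in terms of the coefficients of `x ^ p * f` and `x ^ p * g`. -/
theorem rightResultant_eq {f g : SkewPoly δ} {m n N : ℕ} (hm : f.natDegree = m)
    (hn : g.natDegree = n) (hN : n + m = N) :
    f.rightResultant g = Dieudonne.ddet N (Matrix.of fun r q : Fin N =>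
      if (r : ℕ) < n then ((xMul δ ^ (r : ℕ)) f).coeff q
      else ((xMul δ ^ ((r : ℕ) - n)) g).coeff q) := by
  subst hm hn hN
  unfold rightResultant
  congr 1
  ext r q
  refine Fin.addCases (fun p => ?_) (fun p => ?_) r
  · simp [sylvester, sylvesterEntry_eq_coeff]
  · simp [sylvester, sylvesterEntry_eq_coeff]

end SkewPoly

/-! ### The five properties of the resultant. -/

namespace SkewPoly

variable {F : Type*} [DivisionRing F] {σ : F →+* F} {δ : SkewDerivation σ}

open Dieudonne

theorem val_finRotate_pow {N : ℕ} (n : ℕ) (r : Fin N) :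
    (((finRotate N ^ n) r : Fin N) : ℕ) = (r + n) % N := by
  obtain _ | N := N
  · exact r.elim0
  induction n with
  | zero => simp [Nat.mod_eq_of_lt r.isLt]
  | succ n ih =>
    rw [pow_succ', Equiv.Perm.mul_apply, finRotate_apply, Fin.val_add, ih, Fin.val_one',
      ← Nat.add_mod, add_assoc]

/-- The left side is the sign of the `n`-th power of the cyclic rotation of `n + m` rows; the
exponents differ by the even number `n * (n - 1)`. -/
theorem neg_one_pow_block_rotation (m n : ℕ) :
    (-1 : ℤˣ) ^ ((n + m - 1) * n) = (-1) ^ (m * n) := by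
  obtain _ | n := n
  · simp
  have : (n + 1 + m - 1) * (n + 1) = n * (n + 1) + m * (n + 1) := by
    rw [Nat.add_right_comm, Nat.add_sub_cancel, add_mul]
  rw [this, pow_add, (Nat.even_mul_succ_self n).neg_one_pow, one_mul]

theorem rightResultant_swap (f g : SkewPoly δ) :
    g.rightResultant f = cls ((-1) ^ (f.natDegree * g.natDegree)) * f.rightResultant g := by
  rw [rightResultant_eq (f := f) (g := g) rfl rfl rfl,
    rightResultant_eq (f := g) (g := f) rfl rfl (add_comm _ _)]
  -- Rotation by `n = deg g` places sends row `r < deg f` to row `r + n`, the row of `x ^ r * g`,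
  -- and wraps the other indices around to the rows of `f`.
  have h := ddet_permute (Matrix.of fun r q : Fin (g.natDegree + f.natDegree) =>
      if (r : ℕ) < g.natDegree then ((xMul δ ^ (r : ℕ)) f).coeff q
      else ((xMul δ ^ ((r : ℕ) - g.natDegree)) g).coeff q)
      (finRotate (g.natDegree + f.natDegree) ^ g.natDegree)
  rw [map_pow, sign_finRotate, ← pow_mul, neg_one_pow_block_rotation] at h
  simp only [Units.val_pow_eq_pow_val, Units.val_neg, Units.val_one, Int.cast_pow, Int.cast_neg,
    Int.cast_one] at h
  rw [← h]
  congr 1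
  ext r q
  simp only [Matrix.submatrix_apply, Matrix.of_apply, val_finRotate_pow, id]
  have := r.isLt
  by_cases hr : (r : ℕ) < f.natDegree
  · rw [if_pos hr, Nat.mod_eq_of_lt (by omega), if_neg (by omega), Nat.add_sub_cancel]
  · have : ((r : ℕ) + g.natDegree) % (g.natDegree + f.natDegree) = r - f.natDegree := by
      rw [Nat.mod_eq_sub_mod (by omega), Nat.mod_eq_of_lt (by omega)]
      omega
    rw [if_neg hr, this, if_pos (by omega)]

/-- Scaling the first block of rows of the Sylvester matrix. -/
theorem rightResultant_of_rows_scaled {f f' g : SkewPoly δ} (hd : f'.natDegree = f.natDegree)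
    (c : ℕ → F) (hc : ∀ p, c p ≠ 0)
    (h : ∀ p, (xMul δ ^ p) f' = c p • (xMul δ ^ p) f) :
    f'.rightResultant g = (∏ p ∈ Finset.range g.natDegree, cls (c p)) * f.rightResultant g := by
  rw [rightResultant_eq hd rfl rfl, rightResultant_eq (f := f) (g := g) rfl rfl rfl]
  have hs := ddet_scale (Matrix.of fun r q : Fin (g.natDegree + f.natDegree) =>
      if (r : ℕ) < g.natDegree then ((xMul δ ^ (r : ℕ)) f).coeff q
      else ((xMul δ ^ ((r : ℕ) - g.natDegree)) g).coeff q)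
      (fun r => if (r : ℕ) < g.natDegree then c r else 1)
      (fun r => by split_ifs; exacts [hc _, one_ne_zero])
  rw [Fin.prod_univ_eq_prod_range (fun r => cls (if r < g.natDegree then c r else 1)),
    Finset.prod_range_add] at hs
  have h1 : ∏ x ∈ Finset.range f.natDegree,
      cls (if g.natDegree + x < g.natDegree then c (g.natDegree + x) else 1) = 1 :=
    Finset.prod_eq_one fun x _ => by rw [if_neg (by omega), cls_one]
  have h2 : ∏ x ∈ Finset.range g.natDegree, cls (if x < g.natDegree then c x else 1) =
      ∏ x ∈ Finset.range g.natDegree, cls (c x) :=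
    Finset.prod_congr rfl fun x hx => by rw [if_pos (Finset.mem_range.1 hx)]
  rw [h1, h2, mul_one] at hs
  rw [← hs]
  congr 1
  ext r q
  simp only [Matrix.of_apply]
  split_ifs
  · rw [h, coeff_smul]
  · rw [one_mul]

theorem rightResultant_neg_left (f g : SkewPoly δ) :
    (-f).rightResultant g = cls ((-1) ^ g.natDegree) * f.rightResultant g := by
  rw [rightResultant_of_rows_scaled (natDegree_neg f) (fun _ => -1)
    (fun _ => neg_ne_zero.2 one_ne_zero) (fun p => by rw [map_neg, neg_smul, one_smul])]
  simp [cls_pow]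

theorem rightResultant_neg_right (f g : SkewPoly δ) :
    f.rightResultant (-g) = cls ((-1) ^ f.natDegree) * f.rightResultant g := by
  rw [rightResultant_swap (-g) f, rightResultant_neg_left, rightResultant_swap f g, natDegree_neg,
    mul_left_comm, ← mul_assoc (cls ((-1) ^ (g.natDegree * _))), ← cls_mul,
    mul_comm g.natDegree, ← pow_add, Even.neg_one_pow ⟨_, rfl⟩, cls_one, one_mul]

theorem rightResultant_C_right (f : SkewPoly δ) (b : F) :
    f.rightResultant (C b) = cls ((List.range f.natDegree).map fun i => σ^[i] b).prod := by
  have hC : ∀ i, 0 < i → (C b : SkewPoly δ).coeff i = 0 := fun i hi => by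
    rw [coeff_C, if_neg hi.ne]
  have hd : (C b : SkewPoly δ).natDegree = 0 := by
    by_contra h
    have h0 := hC _ (Nat.pos_of_ne_zero h)
    exact coeff_natDegree_ne_zero (fun h' => h (by rw [h']; rfl)) h0
  rw [rightResultant_eq rfl hd (zero_add _), ddet_of_lowerTriangular]
  · have h1 : ∀ p : ℕ, ((xMul δ ^ p) (C b)).coeff p = σ^[p] b := fun p => by
      have := coeff_xMul_pow_top hC p
      rwa [zero_add, coeff_C, if_pos rfl] at this
    simp only [Matrix.of_apply, Nat.not_lt_zero, if_false, Nat.sub_zero, h1]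
    rw [Fin.prod_univ_eq_prod_range (fun p => cls (σ^[p] b))]
    induction f.natDegree with
    | zero => simp [cls_one]
    | succ m ih => rw [Finset.prod_range_succ, ih, ← cls_mul, List.range_succ]; simp
  · intro i j hij
    simp only [Matrix.of_apply, Nat.not_lt_zero, if_false, Nat.sub_zero]
    exact coeff_xMul_pow_of_lt hC _ _ (by rw [zero_add]; exact hij)

/-- There is one row for `f`, and subtracting left multiples of the rows `x ^ j * (x - a)`, with the
coefficients of the quotient, leaves only the remainder in it. The other rows are monic, with their
leading `1` on the diagonal. -/
theorem rightResultant_X_sub_C (f : SkewPoly δ) (a : F) :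
    f.rightResultant (X - C a) = cls (f.rightEval a) := by
  obtain ⟨c, hc⟩ := exists_eq_sum_add_rightEval f a
  -- Row `j ≥ 1` holds `x ^ (j - 1) * (x - a)`, hence the shifted index; the image of `Fin.succEmb`
  -- is the set of all rows except row `0`.
  rw [rightResultant_eq rfl (natDegree_X_sub_C a) (add_comm 1 _),
    ← ddet_add_row_sum _ 0 (fun j => -c ((j : ℕ) - 1)) (Finset.univ.map (Fin.succEmb _)) (by simp)]
  have hrow : ∀ q : ℕ, f.coeff q + ∑ j : Fin f.natDegree,
      -c j * ((xMul δ ^ (j : ℕ)) (X - C a)).coeff q = if 0 = q then f.rightEval a else 0 := by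
    intro q
    rw [Fin.sum_univ_eq_sum_range (fun j => -c j * ((xMul δ ^ j) (X - C a)).coeff q), ← coeff_C]
    have h := congrArg (fun p => coeff p q) hc
    simp only [coeff_add, coeff_sum, coeff_smul] at h
    rw [h]
    simp only [neg_mul, Finset.sum_neg_distrib]
    abel
  have htop : ∀ j : ℕ, ((xMul δ ^ j) (X - C a)).coeff (j + 1) = 1 := fun j => by
    rw [add_comm, coeff_xMul_pow_top (coeff_X_sub_C_of_lt a), coeff_X_sub_C_one, iterate_map_one]
  simp only [Finset.sum_map, Matrix.of_apply, Fin.coe_succEmb, Fin.val_succ, Fin.val_zero,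
    Nat.add_sub_cancel, zero_lt_one, if_true, add_lt_iff_neg_right, Nat.not_lt_zero, if_false,
    pow_zero]
  have hrow' : ∀ q : ℕ, ((1 : AddMonoid.End (SkewPoly δ)) f).coeff q + ∑ j : Fin f.natDegree,
      -c j * ((xMul δ ^ (j : ℕ)) (X - C a)).coeff q = if 0 = q then f.rightEval a else 0 := hrow
  simp only [hrow']
  rw [ddet_of_lowerTriangular]
  · rw [Fin.prod_univ_succ, Finset.prod_eq_one, mul_one]
    · simp
    · intro j _
      simp only [Matrix.of_apply, if_neg (Fin.succ_ne_zero j), Fin.val_succ, Nat.add_sub_cancel,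
        add_lt_iff_neg_right, Nat.not_lt_zero, if_false, htop, cls_one]
  · intro i j hij
    rcases Fin.eq_zero_or_eq_succ i with rfl | ⟨i, rfl⟩
    · have : (0 : ℕ) ≠ j := by rw [Fin.lt_def] at hij; exact hij.ne
      simp [this]
    · rw [Fin.lt_def, Fin.val_succ] at hij
      have := coeff_xMul_pow_of_lt (δ := δ) (coeff_X_sub_C_of_lt a) i j (by omega)
      simpa [Fin.succ_ne_zero] using this

theorem rightResultant_C_mul_left (h : δ = 0) {c : F} (hc : c ≠ 0) (f g : SkewPoly δ) :
    (C c * f).rightResultant g = cls (truncNorm δ c g.natDegree) * f.rightResultant g := by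
  -- The definition of `truncNorm` adds a factor `c` on the right; this form adds the top factor
  -- `σ^n(c)` on the left, so that the norm is built from the row factors.
  have hN : ∀ n, truncNorm δ c (n + 1) = σ^[n] c * truncNorm δ c n := by
    intro n
    have h0 : ∀ a, δ a = 0 := fun a => by rw [h]; rfl
    have hs : ∀ n, truncNorm δ c (n + 1) = σ (truncNorm δ c n) * c := fun n => by
      rw [truncNorm, h0, add_zero]
    induction n with
    | zero => simp [truncNorm, h0]
    | succ n ih => rw [hs, ih, map_mul, mul_assoc, Function.iterate_succ_apply', ← hs n, ih]
  rw [rightResultant_of_rows_scaled (natDegree_C_mul hc f) (fun p => σ^[p] c)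
    (fun p => by
      rw [← RingHom.coe_pow]
      exact (map_ne_zero _).2 hc)
    (fun p => by rw [C_mul, xMul_pow_smul_of_eq_zero h])]
  congr 1
  induction g.natDegree with
  | zero => simp [truncNorm, cls_one]
  | succ n ih => rw [Finset.prod_range_succ, ih, hN, cls_mul, mul_comm]

end SkewPoly

theorem proposition3p10 {F : Type*} [DivisionRing F] (σ : F →+* F) (δ : SkewDerivation σ)
    (f g : SkewPoly δ) (m n : ℕ) (hf : f ≠ 0) (hg : g ≠ 0)
    (hm : f.natDegree = m) (hn : g.natDegree = n) :
    (g.rightResultant f = Dieudonne.cls ((-1) ^ (m * n)) * f.rightResultant g) ∧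
    ((-f).rightResultant g = Dieudonne.cls ((-1) ^ n) * f.rightResultant g ∧
      f.rightResultant (-g) = Dieudonne.cls ((-1) ^ m) * f.rightResultant g) ∧
    ((∀ a : F, g = SkewPoly.X - SkewPoly.C a →
        (f.rightResultant g = 0 ↔ f.rightEval a = 0)) ∧
      (g = SkewPoly.X - SkewPoly.C 0 →
        f.rightResultant g = Dieudonne.cls (f.rightEval 0))) ∧
    (∀ b₀ : F, g = SkewPoly.C b₀ →
      f.rightResultant g =
        Dieudonne.cls ((List.range m).map fun i => σ^[i] b₀).prod) ∧
    (δ = 0 → ∀ c : F, c ≠ 0 →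
      (SkewPoly.C c * f).rightResultant g =
        Dieudonne.cls (SkewPoly.truncNorm δ c n) * f.rightResultant g) := by
  subst hm hn
  refine ⟨SkewPoly.rightResultant_swap f g, ⟨SkewPoly.rightResultant_neg_left f g,
    SkewPoly.rightResultant_neg_right f g⟩, ⟨?_, ?_⟩, ?_, ?_⟩
  · rintro a rfl
    rw [SkewPoly.rightResultant_X_sub_C, Dieudonne.cls_eq_zero]
  · rintro rfl
    exact SkewPoly.rightResultant_X_sub_C f 0
  · rintro b rfl
    exact SkewPoly.rightResultant_C_right f b
  · exact fun h c hc => SkewPoly.rightResultant_C_mul_left h hc f g
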